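/- Let $\Delta\ge 3$ be a fixed integer. For $n$ with $\Delta n$ even, partition a set of $\Delta n$ points into $n$ cells of $\Delta$ points each, choose a perfect matching of the points (a configuration) uniformly at random, and let $G'$ be the corresponding multigraph: its vertices are the $n$ cells, and every matched pair $\{x,y\}$ is an edge between the cell of $x$ and the cell of $y$ (loops and parallel edges are allowed, and $G'$ need not be connected). Let $\delta(a,b)\in\{0,1,2,\dots\}\cup\{\infty\}$ be the number of edges on a shortest path from $a$ to $b$ in $G'$, with $\delta(a,b)=\infty$ if there is none, and let $D(v,w)$ be the set of vertices $u$ of $G'$ with $|\delta(u,v)-\delta(u,w)|>1$, where $u\in D(v,w)$ if exactly one of the two distances is infinite and $u\notin D(v,w)$ if both are. Then there is a function $\varepsilon$, depending only on $\Delta$, with $\varepsilon(n)=o(n^{-2})$ as $n\to\infty$, such that for every $n$ with $\Delta n$ even and every pair of distinct vertices $v,w$, $$\Pr\bigl[\,|D(v,w)|>3n/\log n \;\big|\; \delta(v,w)\ge 2\,\bigr]\;\ge\;1-\varepsilon(n),$$ where $\log$ is the natural logarithm (and, if the conditioning event has probability $0$, which can only happen for boundedly many $n$, the left-hand side is read as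 $0$). -/

import Mathlib

open Filter MeasureTheory ProbabilityTheory

/-- A configuration: `n` cells of `Δ` points each (the point `(i, j)` is the `j`-th point of the
cell `i`), together with a perfect matching of all these points. The matching is given by the
permutation sending each point to the point it is paired with. -/
def Configuration (n Δ : ℕ) : Type :=
  {σ : Equiv.Perm (Fin n × Fin Δ) // (∀ x, σ (σ x) = x) ∧ ∀ x, σ x ≠ x}

namespace Configuration

variable {n Δ : ℕ}

/-- The multigraph of a configuration: the vertices are the cells, and each pair `{x, σ x}` of
matched points is an edge joining the cell of `x` to the cell of `σ x`. Loops and parallel edges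
are allowed. -/
def multigraph (c : Configuration n Δ) : Graph (Fin n) (Sym2 (Fin n × Fin Δ)) where
  vertexSet := Set.univ
  IsLink e a b := ∃ x, e = s(x, c.1 x) ∧ x.1 = a ∧ (c.1 x).1 = b
  isLink_symm := by
    rintro e -
    refine ⟨fun a b => ?_⟩
    rintro ⟨x, rfl, rfl, rfl⟩
    exact ⟨c.1 x, by rw [c.2.1 x, Sym2.eq_swap], rfl, by rw [c.2.1 x]⟩
  eq_or_eq_of_isLink_of_isLink := by
    rintro e a b a' b' ⟨x, rfl, rfl, rfl⟩ ⟨y, h, rfl, rfl⟩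
    rcases Sym2.eq_iff.1 h with ⟨h1, -⟩ | ⟨h1, -⟩
    · exact Or.inl (congrArg Prod.fst h1)
    · exact Or.inr (congrArg Prod.fst h1)
  left_mem_of_isLink := fun _ _ _ _ => Set.mem_univ _

/-- All events are measurable in the finite space of configurations. -/
instance : MeasurableSpace (Configuration n Δ) := ⊤

end Configuration

/-- The distance `δ(a, b)` in a multigraph, the least number of edges of a path from `a` to `b`,
and `⊤` if there is none. Loops and parallel edges do not affect distances, so it is computed in
the simple graph of all pairs of distinct adjacent vertices. -/
noncomputable def multigraphDist {V E : Type*} (G : Graph V E) (a b : V) : ℕ∞ :=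
  (SimpleGraph.fromRel G.Adj).edist a b

/-- The set `D(a, b)` of the vertices `u` with `|δ(u, a) - δ(u, b)| > 1`. If exactly one of the two
distances is infinite, then `u` belongs to `D(a, b)`; if both are, it does not. -/
def distinguishers {V E : Type*} (G : Graph V E) (a b : V) : Set V :=
  {u ∈ G.vertexSet | multigraphDist G u a + 1 < multigraphDist G u b ∨
    multigraphDist G u b + 1 < multigraphDist G u a}

/-- The law of a uniformly random configuration. -/
noncomputable def uniformConfiguration (n Δ : ℕ) : Measure (Configuration n Δ) :=
  uniformOn Set.univ

/-! Put q = Δ - 1 and grow the balls around C = {v, w}. If the ball of radius i were a pair of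
disjoint trees, its boundary would have about 2Δq^(i-1) cells, each much nearer to one root than to
the other. Departure from this is measured by the excess, half of `twiceExcess`. Call a boundary
cell pure if it is reached through tree edges only (`pureSphere`). When δ(v,w) ≥ 2, a pure cell at
radius i has distance at most i from one root and at least i + 2 from the other, so it lies in
D(v,w) (`Configuration.card_pureSphere_le_ncard_distinguishers`). Hence a single large pure sphere
suffices.

Pure spheres multiply by q at each radius, up to a loss bounded by the increase of `twiceExcess`
(`card_pureSphere_succ_ge`). The 2Δ ≥ 6 initial branches survive an excess of at most 2 at a small
radius s, leaving at least 2q^(s-1) pure cells. From s to r, where q^r is of order n, it is enough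
that the excess at radius j is O(q^(2j)/n + log n) (`card_pureSphere_ge`). The sphere at r then has
linearly many pure cells, more than 3n/log n.

The excess is controlled by exposing the matching pair by pair: it is at most the number of pairs
whose second point falls in a discovered cell, an event of conditional probability at most p =
O(q^i/n). An exponential moment gives P(excess ≥ k) ≤ exp(mz)/z^k with m = O(q^(2i)/n)
(`card_twiceExcess_ge_mul_pow_le`). For q^s about n^(1/12), z = 1/m and k = 3 give O(n^(-5/2)); for
larger radii, z = e gives n^(-4) each. Conditioning on δ(v,w) ≥ 2, of probability at least 1/2,
costs a factor 2. -/

/-! ### Balls, excess and pure spheres of a fixed matching. -/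

/-- The cells known to be within distance `i` of `C` when only the pairs of the points in `A` are
known. -/
def knownBall {n Δ : ℕ} (C : Finset (Fin n)) (A : Finset (Fin n × Fin Δ))
    (σ : Equiv.Perm (Fin n × Fin Δ)) : ℕ → Finset (Fin n)
  | 0 => C
  | i + 1 => knownBall C A σ i ∪
      (A.filter fun x => x.1 ∈ knownBall C A σ i).image fun x => (σ x).1

/-- The number of points of `U` matched to points of `T`. -/
def edgeCount {n Δ : ℕ} (σ : Equiv.Perm (Fin n × Fin Δ)) (U T : Finset (Fin n)) : ℕ :=
  (Finset.univ.filter fun x : Fin n × Fin Δ => x.1 ∈ U ∧ (σ x).1 ∈ T).card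

/-- The number of points of the cell `y` matched to points of `T`. -/
def degInto {n Δ : ℕ} (σ : Equiv.Perm (Fin n × Fin Δ)) (y : Fin n) (T : Finset (Fin n)) : ℕ :=
  (Finset.univ.filter fun j : Fin Δ => (σ (y, j)).1 ∈ T).card

/-- The ball of radius `i` around `C`. -/
abbrev fullBall {n Δ : ℕ} (C : Finset (Fin n)) (σ : Equiv.Perm (Fin n × Fin Δ)) (i : ℕ) :
    Finset (Fin n) :=
  knownBall C Finset.univ σ i

/-- Twice the excess of the subgraph induced on the ball of radius `i`. -/
def twiceExcess {n Δ : ℕ} (C : Finset (Fin n)) (σ : Equiv.Perm (Fin n × Fin Δ)) (i : ℕ) : ℤ :=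
  edgeCount σ (fullBall C σ i) (fullBall C σ i) + 2 * C.card - 2 * (fullBall C σ i).card

/-- The cells at distance `i` that are joined to `C` by a path meeting no cycle of the ball. -/
def pureSphere {n Δ : ℕ} (C : Finset (Fin n)) (σ : Equiv.Perm (Fin n × Fin Δ)) :
    ℕ → Finset (Fin n)
  | 0 => C
  | i + 1 => (fullBall C σ (i + 1) \ fullBall C σ i).filter fun y =>
      degInto σ y (fullBall C σ (i + 1)) = 1 ∧
      ∀ j, (σ (y, j)).1 ∈ fullBall C σ (i + 1) → (σ (y, j)).1 ∈ pureSphere C σ i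

section
variable {n Δ : ℕ} {C : Finset (Fin n)} {A A' : Finset (Fin n × Fin Δ)}
  {σ τ : Equiv.Perm (Fin n × Fin Δ)}

lemma knownBall_subset_succ (i : ℕ) : knownBall C A σ i ⊆ knownBall C A σ (i + 1) :=
  Finset.subset_union_left

lemma knownBall_mono : Monotone (knownBall C A σ) :=
  monotone_nat_of_le_succ knownBall_subset_succ

lemma mem_knownBall_succ {i : ℕ} {y : Fin n} : y ∈ knownBall C A σ (i + 1) ↔
    y ∈ knownBall C A σ i ∨ ∃ x ∈ A, x.1 ∈ knownBall C A σ i ∧ (σ x).1 = y := by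
  simp only [knownBall, Finset.mem_union, Finset.mem_image, Finset.mem_filter, and_assoc]

lemma knownBall_congr (h : ∀ a ∈ A, σ a = τ a) (i : ℕ) :
    knownBall C A σ i = knownBall C A τ i := by
  induction i with
  | zero => rfl
  | succ i ih =>
    ext y
    rw [mem_knownBall_succ, mem_knownBall_succ, ih]
    refine or_congr Iff.rfl (exists_congr fun x => and_congr_right fun hx => ?_)
    rw [h x hx]

lemma knownBall_subset (h : A ⊆ A') (i : ℕ) : knownBall C A σ i ⊆ knownBall C A' σ i := by
  induction i with
  | zero => exact subset_rfl
  | succ i ih =>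
    intro y
    rw [mem_knownBall_succ, mem_knownBall_succ]
    rintro (hy | ⟨x, hx, hxb, rfl⟩)
    · exact Or.inl (ih hy)
    · exact Or.inr ⟨x, h hx, ih hxb, rfl⟩

lemma knownBall_subset_image (i : ℕ) (hA : ∀ a ∈ A, σ a ∈ A) :
    knownBall C A σ i ⊆ C ∪ A.image Prod.fst := by
  induction i with
  | zero => exact Finset.subset_union_left
  | succ i ih =>
    intro y
    rw [mem_knownBall_succ]
    rintro (hy | ⟨x, hx, hxb, rfl⟩)
    · exact ih hy
    · exact Finset.mem_union_right _ (Finset.mem_image_of_mem _ (hA x hx))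

/-- Once every point of the known ball has been exposed, no unexposed pair can enlarge it. -/
lemma fullBall_eq_knownBall {i : ℕ} (h : ∀ x, x.1 ∈ knownBall C A σ i → x ∈ A) {j : ℕ}
    (hj : j ≤ i) : fullBall C σ j = knownBall C A σ j := by
  induction j with
  | zero => rfl
  | succ j ih =>
    have ih := ih (by omega)
    refine subset_antisymm ?_ (knownBall_subset (Finset.subset_univ _) _)
    intro y
    rw [mem_knownBall_succ, mem_knownBall_succ, ← fullBall, ih]
    rintro (hy | ⟨x, hx, hxb, rfl⟩)
    · exact Or.inl hy
    · exact Or.inr ⟨x, h x (knownBall_mono (by omega) hxb), hxb, rfl⟩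

lemma edgeCount_eq_sum (U T : Finset (Fin n)) :
    edgeCount σ U T = ∑ y ∈ U, degInto σ y T := by
  classical
  simp only [edgeCount, degInto, Finset.card_filter, ← Finset.univ_product_univ,
    Finset.sum_product]
  rw [← Finset.sum_filter_add_sum_filter_not Finset.univ (· ∈ U)]
  rw [Finset.sum_eq_zero (s := Finset.univ.filter fun x => x ∉ U), add_zero]
  · simp only [Finset.filter_mem_eq_inter, Finset.univ_inter]
    refine Finset.sum_congr rfl fun y hy => ?_
    simp [hy]
  · intro y hy
    simp only [Finset.mem_filter] at hy
    simp [hy.2]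

lemma edgeCount_comm (hσ : ∀ x, σ (σ x) = x) (U T : Finset (Fin n)) :
    edgeCount σ U T = edgeCount σ T U := by
  refine Finset.card_bij (fun x _ => σ x) ?_ (fun _ _ _ _ h => σ.injective h) ?_
  · intro x hx
    simp only [Finset.mem_filter, Finset.mem_univ, true_and] at hx ⊢
    exact ⟨hx.2, by rw [hσ]; exact hx.1⟩
  · intro x hx
    simp only [Finset.mem_filter, Finset.mem_univ, true_and] at hx
    exact ⟨σ x, by simp [hσ, hx], hσ x⟩

lemma degInto_union {y : Fin n} {T T' : Finset (Fin n)} (h : Disjoint T T') :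
    degInto σ y (T ∪ T') = degInto σ y T + degInto σ y T' := by
  rw [degInto, degInto, degInto, ← Finset.card_union_of_disjoint]
  · congr 1
    ext j
    simp
  · rw [Finset.disjoint_filter]
    exact fun j _ h1 h2 => Finset.disjoint_left.1 h h1 h2

lemma degInto_mono {y : Fin n} {T T' : Finset (Fin n)} (h : T ⊆ T') :
    degInto σ y T ≤ degInto σ y T' :=
  Finset.card_le_card (Finset.monotone_filter_right _ fun _ _ hj => h hj)

lemma degInto_pos {y : Fin n} {T : Finset (Fin n)} :
    0 < degInto σ y T ↔ ∃ j, (σ (y, j)).1 ∈ T := by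
  simp [degInto, Finset.card_pos, Finset.Nonempty]

lemma degInto_eq_of_forall {y : Fin n} {T : Finset (Fin n)} (h : ∀ j, (σ (y, j)).1 ∈ T) :
    degInto σ y T = Δ := by
  simp [degInto, h]

lemma fst_apply_mem_fullBall_succ {i : ℕ} {x : Fin n × Fin Δ} (h : x.1 ∈ fullBall C σ i) :
    (σ x).1 ∈ fullBall C σ (i + 1) :=
  mem_knownBall_succ.2 (Or.inr ⟨x, Finset.mem_univ _, h, rfl⟩)

lemma degInto_pos_of_mem_sdiff (hσ : ∀ x, σ (σ x) = x) {i : ℕ} {y : Fin n}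
    (hy : y ∈ fullBall C σ (i + 1) \ fullBall C σ i) : 0 < degInto σ y (fullBall C σ i) := by
  rw [Finset.mem_sdiff, mem_knownBall_succ] at hy
  obtain ⟨hy | ⟨x, -, hx, rfl⟩, hy'⟩ := hy
  · exact absurd hy hy'
  · exact degInto_pos.2 ⟨(σ x).2, by rw [Prod.mk.eta, hσ]; exact hx⟩

lemma degInto_succ (i : ℕ) (y : Fin n) : degInto σ y (fullBall C σ (i + 1)) =
    degInto σ y (fullBall C σ i) + degInto σ y (fullBall C σ (i + 1) \ fullBall C σ i) := by
  rw [← degInto_union Finset.disjoint_sdiff,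
    Finset.union_sdiff_of_subset (knownBall_subset_succ i)]

/-- A new cell y adds one vertex, its points matched into the old ball count twice (once from each
end), and those matched into the new sphere count once from y. -/
lemma twiceExcess_succ (hσ : ∀ x, σ (σ x) = x) (i : ℕ) :
    twiceExcess C σ (i + 1) = twiceExcess C σ i +
      ∑ y ∈ fullBall C σ (i + 1) \ fullBall C σ i,
        ((degInto σ y (fullBall C σ i) + degInto σ y (fullBall C σ (i + 1)) : ℤ) - 2) := by
  set B := fullBall C σ i with hB
  set S := fullBall C σ (i + 1) \ fullBall C σ i with hS
  have hsub : B ⊆ fullBall C σ (i + 1) := knownBall_subset_succ i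
  have hd : Disjoint B S := Finset.disjoint_sdiff
  have hun : fullBall C σ (i + 1) = B ∪ S := (Finset.union_sdiff_of_subset hsub).symm
  have h1 : ∀ T, edgeCount σ (B ∪ S) T = edgeCount σ B T + edgeCount σ S T := fun T => by
    simp only [edgeCount_eq_sum, Finset.sum_union hd]
  have h2 : edgeCount σ B (B ∪ S) = edgeCount σ B B + edgeCount σ S B := by
    rw [edgeCount_comm hσ, h1]
  rw [twiceExcess, twiceExcess, ← hB, hun, h1, h2, Finset.card_union_of_disjoint hd,
    Finset.sum_sub_distrib, Finset.sum_add_distrib, ← Nat.cast_sum, ← Nat.cast_sum,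
    ← edgeCount_eq_sum, ← edgeCount_eq_sum]
  simp
  ring

lemma twiceExcess_zero : twiceExcess C σ 0 = edgeCount σ C C := by
  simp [twiceExcess, fullBall, knownBall]

lemma twiceExcess_mono (hσ : ∀ x, σ (σ x) = x) : Monotone (twiceExcess C σ) := by
  refine monotone_nat_of_le_succ fun i => ?_
  rw [twiceExcess_succ hσ, le_add_iff_nonneg_right]
  refine Finset.sum_nonneg fun y hy => ?_
  have h1 := degInto_pos_of_mem_sdiff hσ hy
  have h2 := degInto_mono (σ := σ) (y := y) (knownBall_subset_succ (C := C) (A := .univ) (σ := σ) i)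
  rw [← fullBall, ← fullBall] at h2
  omega

lemma twiceExcess_nonneg (hσ : ∀ x, σ (σ x) = x) (i : ℕ) : 0 ≤ twiceExcess C σ i :=
  le_trans (by rw [twiceExcess_zero]; positivity) (twiceExcess_mono hσ (Nat.zero_le i))

lemma edgeCount_fullBall_add (i : ℕ) :
    edgeCount σ (fullBall C σ i) (fullBall C σ i) +
      edgeCount σ (fullBall C σ i) (fullBall C σ (i + 1) \ fullBall C σ i) =
        Δ * (fullBall C σ i).card := by
  rw [edgeCount_eq_sum, edgeCount_eq_sum, ← Finset.sum_add_distrib,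
    Finset.sum_congr rfl (fun y _ => (degInto_succ i y).symm), Finset.sum_congr rfl fun y hy =>
      degInto_eq_of_forall fun j => fst_apply_mem_fullBall_succ (x := (y, j)) hy]
  simp [mul_comm]

/-- Nonnegative excess means that at least 2|B| - 2|C| points of the ball B are matched inside B, so
few are left to reach new cells. -/
lemma card_fullBall_succ_le (hσ : ∀ x, σ (σ x) = x) (i : ℕ) :
    ((fullBall C σ (i + 1)).card : ℤ) ≤ (Δ - 1) * (fullBall C σ i).card + 2 * C.card := by
  have h1 := edgeCount_fullBall_add (C := C) (σ := σ) i
  have h2 : (fullBall C σ (i + 1) \ fullBall C σ i).card ≤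
      edgeCount σ (fullBall C σ i) (fullBall C σ (i + 1) \ fullBall C σ i) := by
    rw [edgeCount_comm hσ, edgeCount_eq_sum, Finset.card_eq_sum_ones]
    exact Finset.sum_le_sum fun y hy => degInto_pos_of_mem_sdiff hσ hy
  have h3 := twiceExcess_nonneg (C := C) hσ i
  rw [twiceExcess] at h3
  have h4 := Finset.card_sdiff_add_card_eq_card
    (knownBall_subset_succ (C := C) (A := .univ) (σ := σ) i)
  rw [← fullBall, ← fullBall] at h4
  zify at h1 h2 h4
  linarith

lemma card_fullBall_le (hσ : ∀ x, σ (σ x) = x) (hΔ : 3 ≤ Δ) (hC : C.card = 2) (i : ℕ) :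
    (fullBall C σ i).card ≤ 6 * (Δ - 1) ^ i := by
  -- Subtracting 4 absorbs the additive 2|C| = 4 of the recursion, since 4q ≥ 8.
  suffices h : ((fullBall C σ i).card : ℤ) ≤ 6 * (Δ - 1) ^ i - 4 by
    zify
    rw [Nat.cast_sub (by omega)]
    push_cast
    linarith
  induction i with
  | zero => simp [fullBall, knownBall, hC]
  | succ i ih =>
    have h := card_fullBall_succ_le (C := C) hσ i
    rw [hC] at h
    have hq : (2 : ℤ) ≤ Δ - 1 := by omega
    have := mul_le_mul_of_nonneg_left ih (by omega : (0 : ℤ) ≤ Δ - 1)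
    rw [pow_succ]
    push_cast at h
    linarith

lemma pureSphere_subset (i : ℕ) : pureSphere C σ i ⊆ fullBall C σ i := by
  cases i with
  | zero => exact subset_rfl
  | succ i => exact (Finset.filter_subset _ _).trans Finset.sdiff_subset

/-- Compare cell by cell over the new sphere. A pure cell receives one edge and adds no excess. An
impure cell touched by the pure sphere has at least two edges into the new ball, so its excess term
is at least its number of edges into the old ball. -/
lemma edgeCount_pureSphere_le (hσ : ∀ x, σ (σ x) = x) (i : ℕ) :
    edgeCount σ (pureSphere C σ i) (fullBall C σ (i + 1) \ fullBall C σ i) + twiceExcess C σ i ≤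
      (pureSphere C σ (i + 1)).card + twiceExcess C σ (i + 1) := by
  rw [twiceExcess_succ hσ, edgeCount_comm hσ, edgeCount_eq_sum, pureSphere, Finset.card_filter]
  push_cast
  rw [add_comm (twiceExcess C σ i), ← add_assoc, add_le_add_iff_right, ← Finset.sum_add_distrib]
  refine Finset.sum_le_sum fun y hy => ?_
  have h1 := degInto_pos_of_mem_sdiff hσ hy
  have h2 := degInto_mono (σ := σ) (y := y) (knownBall_subset_succ (C := C) (A := .univ) (σ := σ) i)
  have h3 := degInto_mono (σ := σ) (y := y) (pureSphere_subset (C := C) (σ := σ) i)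
  rw [← fullBall, ← fullBall] at h2
  split_ifs with h
  · rw [h.1] at h2 ⊢
    omega
  · by_cases h0 : degInto σ y (pureSphere C σ i) = 0
    · rw [h0]; omega
    · have h4 : degInto σ y (fullBall C σ (i + 1)) ≠ 1 := by
        intro h5
        refine h ⟨h5, fun j hj => ?_⟩
        obtain ⟨j', hj'⟩ := degInto_pos.1 (Nat.pos_of_ne_zero h0)
        have hj'' := knownBall_subset_succ i (pureSphere_subset i hj')
        have := Finset.card_le_one.1 h5.le j (by simpa using hj) j' (by simpa using hj'')
        rwa [this]
      omega

lemma edgeCount_pureSphere_succ (i : ℕ) :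
    (edgeCount σ (pureSphere C σ (i + 1)) (fullBall C σ (i + 2) \ fullBall C σ (i + 1)) : ℤ) =
      (Δ - 1) * (pureSphere C σ (i + 1)).card := by
  rw [edgeCount_eq_sum, Nat.cast_sum, Finset.sum_congr rfl (g := fun _ => (Δ - 1 : ℤ))]
  · rw [Finset.sum_const, nsmul_eq_mul, mul_comm]
  · intro y hy
    have h1 : degInto σ y (fullBall C σ (i + 2)) = degInto σ y (fullBall C σ (i + 1)) +
        degInto σ y (fullBall C σ (i + 2) \ fullBall C σ (i + 1)) := degInto_succ (i + 1) y
    have h2 : degInto σ y (fullBall C σ (i + 2)) = Δ := degInto_eq_of_forall fun j => fst_apply_mem_fullBall_succ (C := C) (σ := σ)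
      (x := (y, j)) (pureSphere_subset _ hy)
    have h3 : degInto σ y (fullBall C σ (i + 1)) = 1 := by
      rw [pureSphere, Finset.mem_filter] at hy
      exact hy.2.1
    omega

lemma card_pureSphere_one_ge (hσ : ∀ x, σ (σ x) = x) :
    (Δ * C.card : ℤ) ≤ (pureSphere C σ 1).card + twiceExcess C σ 1 := by
  have h1 := edgeCount_pureSphere_le (C := C) hσ 0
  have h2 := edgeCount_fullBall_add (C := C) (σ := σ) 0
  rw [twiceExcess_zero] at h1
  have h3 : pureSphere C σ 0 = C := rfl
  have h4 : fullBall C σ 0 = C := rfl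
  rw [h3, h4] at h1
  rw [h4] at h2
  zify at h2
  simp only [zero_add] at h1 h2 ⊢
  linarith

lemma card_pureSphere_succ_ge (hσ : ∀ x, σ (σ x) = x) (i : ℕ) :
    (Δ - 1) * ((pureSphere C σ (i + 1)).card : ℤ) + twiceExcess C σ (i + 1) ≤
      (pureSphere C σ (i + 2)).card + twiceExcess C σ (i + 2) := by
  rw [← edgeCount_pureSphere_succ]
  exact edgeCount_pureSphere_le hσ (i + 1)

end

/-! ### Exposing a random matching pair by pair; the exponential moment of the excess. -/

/-- The perfect matchings of the points. -/
def matchings (n Δ : ℕ) : Finset (Equiv.Perm (Fin n × Fin Δ)) :=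
  Finset.univ.filter fun σ => (∀ x, σ (σ x) = x) ∧ ∀ x, σ x ≠ x

/-- The perfect matchings that agree with `τ` on `A`. -/
def extensions {n Δ : ℕ} (A : Finset (Fin n × Fin Δ)) (τ : Equiv.Perm (Fin n × Fin Δ)) :
    Finset (Equiv.Perm (Fin n × Fin Δ)) :=
  (matchings n Δ).filter fun σ => ∀ a ∈ A, σ a = τ a

/-- `A` is a union of matched pairs, each of which meets the ball of radius `i` around `C` known
from `A`. -/
structure IsExplored {n Δ : ℕ} (C : Finset (Fin n)) (i : ℕ) (A : Finset (Fin n × Fin Δ))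
    (τ : Equiv.Perm (Fin n × Fin Δ)) : Prop where
  mem : τ ∈ matchings n Δ
  closed : ∀ a ∈ A, τ a ∈ A
  meets : ∀ a ∈ A, a.1 ∈ knownBall C A τ i ∨ (τ a).1 ∈ knownBall C A τ i

section
variable {n Δ : ℕ} {C : Finset (Fin n)} {A : Finset (Fin n × Fin Δ)}
  {σ τ : Equiv.Perm (Fin n × Fin Δ)} {i : ℕ} {x y y' : Fin n × Fin Δ}

lemma mem_matchings : σ ∈ matchings n Δ ↔ (∀ x, σ (σ x) = x) ∧ ∀ x, σ x ≠ x := by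
  simp [matchings]

lemma mem_extensions :
    σ ∈ extensions A τ ↔ σ ∈ matchings n Δ ∧ ∀ a ∈ A, σ a = τ a := by
  simp [extensions]

/-- Conjugation by the transposition of y and y' injects one fibre into the other. Applied both
ways, it shows that the partner of x is uniform on the available points. -/
lemma card_extensions_filter_le (hA : ∀ a ∈ A, τ a ∈ A) (hy : y ∉ insert x A)
    (hy' : y' ∉ insert x A) : ((extensions A τ).filter fun σ => σ x = y).card ≤
      ((extensions A τ).filter fun σ => σ x = y').card := by
  refine Finset.card_le_card_of_injOn
    (fun σ => Equiv.swap y y' * σ * Equiv.swap y y') ?_ ?_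
  · intro σ hσ
    simp only [Finset.coe_filter, Set.mem_ofPred_eq, mem_extensions, mem_matchings,
      Finset.mem_insert, not_or] at hσ hy hy' ⊢
    obtain ⟨⟨⟨h1, h2⟩, h3⟩, h4⟩ := hσ
    refine ⟨⟨⟨fun z => ?_, fun z hz => ?_⟩, fun a ha => ?_⟩, ?_⟩
    · simp [h1]
    · apply h2 (Equiv.swap y y' z)
      apply (Equiv.swap y y').injective
      rw [Equiv.swap_apply_self]
      exact hz
    · have hne : ∀ b ∈ A, Equiv.swap y y' b = b := fun b hb =>
        Equiv.swap_apply_of_ne_of_ne (fun h => hy.2 (h ▸ hb)) (fun h => hy'.2 (h ▸ hb))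
      simp only [Equiv.Perm.mul_apply]
      rw [hne a ha, h3 a ha, hne _ (hA a ha)]
    · simp only [Equiv.Perm.mul_apply]
      rw [Equiv.swap_apply_of_ne_of_ne (Ne.symm hy.1) (Ne.symm hy'.1), h4,
        Equiv.swap_apply_left]
  · intro σ _ σ' _ h
    simpa using h

lemma apply_notMem_insert (hA : ∀ a ∈ A, τ a ∈ A) (hx : x ∉ A) (hσ : σ ∈ extensions A τ) :
    σ x ∉ insert x A := by
  rw [mem_extensions, mem_matchings] at hσ
  rw [Finset.mem_insert, not_or]
  refine ⟨hσ.1.2 x, fun h => hx ?_⟩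
  have := hA _ h
  rwa [← hσ.2 _ h, hσ.1.1] at this

lemma IsExplored.self_mem (h : IsExplored C i A τ) : τ ∈ extensions A τ :=
  mem_extensions.2 ⟨h.mem, fun _ _ => rfl⟩

lemma IsExplored.insert_pair (h : IsExplored C i A τ) (hx : x ∉ A) (hxb : x.1 ∈ knownBall C A τ i)
    (hσ : σ ∈ extensions A τ) : IsExplored C i (insert x (insert (σ x) A)) σ := by
  have hσ' := mem_extensions.1 hσ
  have hinv := (mem_matchings.1 hσ'.1).1
  have hsub : knownBall C A τ i ⊆ knownBall C (insert x (insert (σ x) A)) σ i := by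
    rw [← knownBall_congr hσ'.2]
    exact knownBall_subset (fun a ha => by simp [ha]) _
  refine ⟨hσ'.1, fun a ha => ?_, fun a ha => ?_⟩
  · simp only [Finset.mem_insert] at ha ⊢
    obtain rfl | rfl | ha := ha
    · simp
    · simp [hinv]
    · rw [hσ'.2 a ha]
      exact Or.inr (Or.inr (h.closed a ha))
  · simp only [Finset.mem_insert] at ha
    obtain rfl | rfl | ha := ha
    · exact Or.inl (hsub hxb)
    · rw [hinv]
      exact Or.inr (hsub hxb)
    · rw [hσ'.2 a ha]
      exact (h.meets a ha).imp (fun h => hsub h) (fun h => hsub h)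

lemma IsExplored.card_insert_pair (h : IsExplored C i A τ) (hx : x ∉ A) (hσ : σ ∈ extensions A τ) :
    (insert x (insert (σ x) A)).card = A.card + 2 := by
  have h1 := apply_notMem_insert h.closed hx hσ
  rw [Finset.mem_insert, not_or] at h1
  rw [Finset.card_insert_of_notMem, Finset.card_insert_of_notMem h1.2]
  rw [Finset.mem_insert, not_or]
  exact ⟨Ne.symm h1.1, hx⟩

lemma knownBall_subset_fullBall (j : ℕ) :
    knownBall C A τ j ⊆ fullBall C τ j :=
  knownBall_subset (Finset.subset_univ _) _

lemma card_filter_fst_mem (B : Finset (Fin n)) :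
    (Finset.univ.filter fun x : Fin n × Fin Δ => x.1 ∈ B).card = Δ * B.card := by
  have : (Finset.univ.filter fun x : Fin n × Fin Δ => x.1 ∈ B) = B ×ˢ Finset.univ := by
    ext x; simp
  rw [this, Finset.card_product, Finset.card_univ, Fintype.card_fin, mul_comm]

lemma IsExplored.card_le (h : IsExplored C i A τ) (hΔ : 3 ≤ Δ) (hC : C.card = 2) :
    A.card ≤ 2 * (Δ * (6 * (Δ - 1) ^ i)) := by
  set T := Finset.univ.filter fun x : Fin n × Fin Δ => x.1 ∈ fullBall C τ i with hT
  have hinv := (mem_matchings.1 h.mem).1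
  have hsub : A ⊆ T ∪ T.image τ := by
    intro a ha
    rw [Finset.mem_union, Finset.mem_image]
    obtain h1 | h1 := h.meets a ha
    · exact Or.inl (by simpa [hT] using knownBall_subset_fullBall i h1)
    · exact Or.inr ⟨τ a, by simpa [hT] using knownBall_subset_fullBall i h1, hinv a⟩
  have hTc : T.card ≤ Δ * (6 * (Δ - 1) ^ i) := by
    rw [hT, card_filter_fst_mem]
    exact Nat.mul_le_mul_left _ (card_fullBall_le hinv hΔ hC i)
  calc A.card ≤ _ := Finset.card_le_card hsub
    _ ≤ _ := Finset.card_union_le _ _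
    _ ≤ T.card + T.card := Nat.add_le_add_left Finset.card_image_le _
    _ ≤ _ := by omega

lemma IsExplored.discovered_subset (h : IsExplored C i A τ) :
    C ∪ A.image Prod.fst ⊆ fullBall C τ (i + 1) := by
  have hinv := (mem_matchings.1 h.mem).1
  refine Finset.union_subset (knownBall_mono (C := C) (A := .univ) (Nat.zero_le _)) ?_
  intro y hy
  obtain ⟨a, ha, rfl⟩ := Finset.mem_image.1 hy
  obtain h1 | h1 := h.meets a ha
  · exact knownBall_subset_succ i (knownBall_subset_fullBall i h1)
  · have := fst_apply_mem_fullBall_succ (knownBall_subset_fullBall i h1)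
    rwa [hinv] at this

/-- Each exposed pair lies inside the ball or leaves it, and each discovered cell outside the ball
uses up a leaving pair. Discarding these pairs together with their cells only lowers the right-hand
side to the excess of the ball. -/
lemma IsExplored.twiceExcess_le (h : IsExplored C i A τ)
    (hfull : ∀ x, x.1 ∈ knownBall C A τ i → x ∈ A) (hσ : σ ∈ extensions A τ) :
    twiceExcess C σ i ≤ A.card + 2 * C.card - 2 * (C ∪ A.image Prod.fst).card := by
  have hσ' := mem_extensions.1 hσ
  have hinv := (mem_matchings.1 hσ'.1).1
  have hB : fullBall C σ i = knownBall C A σ i :=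
    fullBall_eq_knownBall (by rwa [knownBall_congr hσ'.2]) le_rfl
  have hB' : fullBall C σ i = knownBall C A τ i := by rw [hB, knownBall_congr hσ'.2]
  set B := fullBall C σ i with hBdef
  have hfull' : ∀ x, x.1 ∈ B → x ∈ A := by rwa [hB']
  have hmeets : ∀ a ∈ A, a.1 ∈ B ∨ (σ a).1 ∈ B := by
    intro a ha
    rw [hσ'.2 a ha, hB']
    exact h.meets a ha
  have hclosed : ∀ a ∈ A, σ a ∈ A := fun a ha => by
    rw [hσ'.2 a ha]; exact h.closed a ha
  have hdisc : B ⊆ C ∪ A.image Prod.fst := hB ▸ knownBall_subset_image i hclosed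
  set O := A.filter fun a => a.1 ∉ B with hO
  set I := Finset.univ.filter fun x : Fin n × Fin Δ => x.1 ∈ B ∧ (σ x).1 ∈ B with hI
  have h1 : (C ∪ A.image Prod.fst) \ B ⊆ O.image Prod.fst := by
    intro y hy
    rw [Finset.mem_sdiff, Finset.mem_union, Finset.mem_image] at hy
    obtain ⟨hy | ⟨a, ha, rfl⟩, hyB⟩ := hy
    · exact absurd (knownBall_mono (C := C) (A := .univ) (σ := σ) (Nat.zero_le i) hy) hyB
    · exact Finset.mem_image_of_mem _ (by simp [hO, ha, hyB])
  have h2 := (Finset.card_le_card h1).trans Finset.card_image_le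
  have h3 := Finset.card_sdiff_add_card_eq_card hdisc
  have h4 : I ∪ (O ∪ O.image σ) ⊆ A := by
    refine Finset.union_subset (fun x hx => ?_) (Finset.union_subset (Finset.filter_subset _ _) ?_)
    · simp only [hI, Finset.mem_filter] at hx
      exact hfull' x hx.2.1
    · intro x hx
      obtain ⟨a, ha, rfl⟩ := Finset.mem_image.1 hx
      exact hclosed a (Finset.mem_filter.1 ha).1
  have h5 : Disjoint O (O.image σ) := by
    rw [Finset.disjoint_right]
    intro x hx hxO
    obtain ⟨a, ha, rfl⟩ := Finset.mem_image.1 hx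
    rw [hO, Finset.mem_filter] at ha hxO
    exact (hmeets a ha.1).elim ha.2 hxO.2
  have h6 : Disjoint I (O ∪ O.image σ) := by
    rw [Finset.disjoint_right]
    intro x hx hxI
    simp only [hI, Finset.mem_filter, Finset.mem_univ, true_and] at hxI
    rw [Finset.mem_union, Finset.mem_image] at hx
    obtain hx | ⟨a, ha, rfl⟩ := hx
    · exact (Finset.mem_filter.1 hx).2 hxI.1
    · rw [hinv] at hxI
      exact (Finset.mem_filter.1 ha).2 hxI.2
  have h7 := Finset.card_le_card h4
  rw [Finset.card_union_of_disjoint h6, Finset.card_union_of_disjoint h5,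
    Finset.card_image_of_injective _ σ.injective] at h7
  have h8 : edgeCount σ B B = I.card := rfl
  rw [twiceExcess, ← hBdef, h8]
  omega

lemma extensions_filter_eq (hσ : σ ∈ extensions A τ) :
    (extensions A τ).filter (fun σ' => σ' x = σ x) =
      extensions (insert x (insert (σ x) A)) σ := by
  have hσ' := mem_extensions.1 hσ
  ext ρ
  simp only [Finset.mem_filter, mem_extensions, Finset.forall_mem_insert, and_assoc,
    and_congr_right_iff]
  intro hρ
  have h1 := (mem_matchings.1 hρ).1
  have h2 := (mem_matchings.1 hσ'.1).1
  constructor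
  · rintro ⟨h3, h4⟩
    exact ⟨h4, by rw [← h4, h1, h4, h2], fun a ha => by rw [h3 a ha, hσ'.2 a ha]⟩
  · rintro ⟨h3, -, h4⟩
    exact ⟨fun a ha => by rw [h4 a ha, hσ'.2 a ha], h3⟩

/-- One exposure step: average over the uniform partner of x. The weight is z when the partner lies
in a discovered cell, of probability at most p, and 1 otherwise; the mean is at most 1 + p(z - 1).
-/
lemma card_extensions_filter_mul_le (hA : ∀ a ∈ A, τ a ∈ A) (hx : x ∉ A) {D : Finset (Fin n)}
    {P : Equiv.Perm (Fin n × Fin Δ) → Prop} [DecidablePred P] {c K z p : ℝ} (hK : 0 ≤ K)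
    (hz : 1 ≤ z)
    (hb : ∀ y, (((extensions A τ).filter P).filter fun σ => σ x = y).card * c ≤
      K * (if y.1 ∈ D then z else 1) * ((extensions A τ).filter fun σ => σ x = y).card)
    (hD : (((insert x A)ᶜ.filter fun y => y.1 ∈ D).card : ℝ) ≤ p * ((insert x A)ᶜ).card) :
    ((extensions A τ).filter P).card * c ≤
      K * (1 + p * (z - 1)) * (extensions A τ).card := by
  set Y := (insert x A)ᶜ with hY
  have hmaps : ∀ σ ∈ extensions A τ, σ x ∈ Y := fun σ hσ => by
    rw [hY, Finset.mem_compl]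
    exact apply_notMem_insert hA hx hσ
  obtain ⟨w, hw⟩ : ∃ w : ℕ, ∀ y ∈ Y, ((extensions A τ).filter fun σ => σ x = y).card = w := by
    rcases Y.eq_empty_or_nonempty with h | ⟨y₀, h₀⟩
    · exact ⟨0, by simp [h]⟩
    · refine ⟨_, fun y hy => le_antisymm (card_extensions_filter_le (y' := y₀) hA ?_ ?_)
        (card_extensions_filter_le hA ?_ ?_)⟩ <;>
      rwa [← Finset.mem_compl]
  have h1 : (extensions A τ).card = Y.card * w := by
    rw [Finset.card_eq_sum_card_fiberwise hmaps, Finset.sum_congr rfl hw, Finset.sum_const,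
      smul_eq_mul]
  have h2 : (((extensions A τ).filter P).card : ℝ) =
      ∑ y ∈ Y, ((((extensions A τ).filter P).filter fun σ => σ x = y).card : ℝ) := by
    rw [← Nat.cast_sum, Finset.card_eq_sum_card_fiberwise
      (fun σ hσ => hmaps σ (Finset.mem_filter.1 hσ).1)]
  have h3 : ∑ y ∈ Y, (if y.1 ∈ D then z else 1) =
      Y.card + (z - 1) * (Y.filter fun y => y.1 ∈ D).card := by
    have : ∀ y : Fin n × Fin Δ, (if y.1 ∈ D then z else 1) =
        1 + (z - 1) * (if y.1 ∈ D then 1 else 0) := fun y => by split_ifs <;> ring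
    simp only [this, Finset.sum_add_distrib, ← Finset.mul_sum, Finset.sum_boole]
    simp
  calc (((extensions A τ).filter P).card : ℝ) * c
      = ∑ y ∈ Y, ((((extensions A τ).filter P).filter fun σ => σ x = y).card : ℝ) * c := by
        rw [h2, Finset.sum_mul]
    _ ≤ ∑ y ∈ Y, K * (if y.1 ∈ D then z else 1) * w := by
        refine Finset.sum_le_sum fun y hy => ?_
        rw [← hw y hy]
        exact hb y
    _ = K * w * (Y.card + (z - 1) * (Y.filter fun y => y.1 ∈ D).card) := by
        rw [← h3, Finset.mul_sum]
        exact Finset.sum_congr rfl fun y _ => by ring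
    _ ≤ K * w * (Y.card + (z - 1) * (p * Y.card)) := by
        have : 0 ≤ z - 1 := by linarith
        gcongr
    _ = _ := by
        rw [h1]
        push_cast
        ring

/-- End of the exploration: e is the number of pairs that discovered no new cell, and `twiceExcess`
is at most 2e, so the event forces k ≤ e. The factor b^d lets the exploration stop with d steps
unspent. -/
lemma IsExplored.card_filter_mul_pow_le (h : IsExplored C i A τ) (hC : C.card = 2) {k t e d : ℕ}
    {z b : ℝ} (hz : 1 ≤ z) (hb : 1 ≤ b) (hA : A.card = 2 * t)
    (he : e + (C ∪ A.image Prod.fst).card = t + 2)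
    (hfull : ∀ x, x.1 ∈ knownBall C A τ i → x ∈ A) :
    (((extensions A τ).filter fun σ => (2 * k : ℤ) ≤ twiceExcess C σ i + 1).card : ℝ) * z ^ k ≤
      z ^ e * b ^ d * (extensions A τ).card := by
  rcases ((extensions A τ).filter fun σ =>
    (2 * k : ℤ) ≤ twiceExcess C σ i + 1).eq_empty_or_nonempty with h0 | ⟨σ, hσ⟩
  · rw [h0]
    simp only [Finset.card_empty, Nat.cast_zero, zero_mul]
    positivity
  · rw [Finset.mem_filter] at hσ
    have h1 := h.twiceExcess_le hfull hσ.1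
    have hke : k ≤ e := by omega
    have h2 : z ^ k ≤ z ^ e * b ^ d :=
      (pow_le_pow_right₀ hz hke).trans (le_mul_of_one_le_right (by positivity) (one_le_pow₀ hb))
    rw [mul_comm]
    gcongr
    exact Finset.filter_subset _ _

/-- Moment bound for the excess of the ball, conditionally on an explored part. -/
theorem IsExplored.card_mul_pow_le (hΔ : 3 ≤ Δ) (hC : C.card = 2) {k : ℕ} {z p : ℝ} (hz : 1 ≤ z)
    (hp : 0 ≤ p) (hpn : ((Δ * (6 * (Δ - 1) ^ (i + 1)) : ℕ) : ℝ) ≤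
      p * (Δ * n - 2 * (Δ * (6 * (Δ - 1) ^ i) : ℕ) - 1)) (d : ℕ) :
    ∀ (t e : ℕ) (A : Finset (Fin n × Fin Δ)) (τ : Equiv.Perm (Fin n × Fin Δ)),
      IsExplored C i A τ → A.card = 2 * t → e + (C ∪ A.image Prod.fst).card = t + 2 →
      t + d = Δ * (6 * (Δ - 1) ^ i) →
      (((extensions A τ).filter fun σ => (2 * k : ℤ) ≤ twiceExcess C σ i + 1).card : ℝ) * z ^ k ≤
        z ^ e * (1 + p * (z - 1)) ^ d * (extensions A τ).card := by
  have hbase : 1 ≤ 1 + p * (z - 1) := by nlinarith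
  induction d with
  | zero =>
    intro t e A τ h hA he hd
    by_cases hfull : ∀ x, x.1 ∈ knownBall C A τ i → x ∈ A
    · exact h.card_filter_mul_pow_le hC hz hbase hA he hfull
    -- With the budget spent no further pair can be exposed: it would exceed the bound on the size
    -- of an explored set.
    · push Not at hfull
      obtain ⟨x, hxb, hx⟩ := hfull
      have h1 := (h.insert_pair hx hxb h.self_mem).card_le hΔ hC
      rw [h.card_insert_pair hx h.self_mem] at h1
      omega
  | succ d ih =>
    intro t e A τ h hA he hd
    by_cases hfull : ∀ x, x.1 ∈ knownBall C A τ i → x ∈ A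
    · exact h.card_filter_mul_pow_le hC hz hbase hA he hfull
    · push Not at hfull
      obtain ⟨x, hxb, hx⟩ := hfull
      have hinv := (mem_matchings.1 h.mem).1
      have hxD : x.1 ∈ C ∪ A.image Prod.fst := knownBall_subset_image i h.closed hxb
      set D := C ∪ A.image Prod.fst with hD
      rw [pow_succ, ← mul_assoc]
      refine card_extensions_filter_mul_le (D := D) h.closed hx (by positivity) hz ?_ ?_
      · intro y
        rcases ((extensions A τ).filter fun σ => σ x = y).eq_empty_or_nonempty with h0 | ⟨σ, hσ⟩
        · rw [Finset.filter_comm, h0]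
          simp
        · rw [Finset.mem_filter] at hσ
          obtain ⟨hσ, rfl⟩ := hσ
          rw [Finset.filter_comm, extensions_filter_eq hσ]
          have hD' : C ∪ (insert x (insert (σ x) A)).image Prod.fst = insert (σ x).1 D := by
            rw [Finset.image_insert, Finset.image_insert, Finset.union_insert, Finset.union_insert,
              ← hD, Finset.insert_eq_of_mem]
            exact Finset.mem_insert_of_mem hxD
          have hA' := h.card_insert_pair hx hσ
          -- The cell of x is already discovered, so only the cell of its partner decides between a
          -- new cell and a unit of e.
          have := ih (t + 1) (e + if (σ x).1 ∈ D then 1 else 0) _ σ (h.insert_pair hx hxb hσ)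
            (by rw [hA', hA]; ring) (by
              rw [hD']
              split_ifs with hm
              · rw [Finset.insert_eq_of_mem hm]; omega
              · rw [Finset.card_insert_of_notMem hm]; omega) (by omega)
          refine this.trans_eq ?_
          split_ifs <;> ring
      · have h1 : ((insert x A)ᶜ.filter fun y => y.1 ∈ D).card ≤
            Δ * (6 * (Δ - 1) ^ (i + 1)) := by
          refine (Finset.card_le_card (Finset.filter_subset_filter _ (Finset.subset_univ _))).trans ?_
          rw [card_filter_fst_mem]
          exact Nat.mul_le_mul_left _ ((Finset.card_le_card h.discovered_subset).trans
            (card_fullBall_le hinv hΔ hC _))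
        have h2 : ((insert x A)ᶜ).card + A.card + 1 = Δ * n := by
          have := Finset.card_compl_add_card (insert x A)
          rw [Finset.card_insert_of_notMem hx] at this
          rw [add_assoc, this]
          simp [mul_comm]
        have h3 := h.card_le hΔ hC
        rify at h1 h2 h3
        refine (Nat.cast_le.2 (by exact_mod_cast h1)).trans (hpn.trans ?_)
        refine mul_le_mul_of_nonneg_left ?_ hp
        push_cast
        linarith

/-- Exponential tail bound for the excess of the ball of radius `i`. -/
theorem card_twiceExcess_ge_mul_pow_le (hΔ : 3 ≤ Δ) (hC : C.card = 2) (k : ℕ) {z : ℝ} (hz : 1 ≤ z)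
    (hn : 24 * Δ * (Δ - 1) ^ i + 2 ≤ Δ * n) :
    (((matchings n Δ).filter fun σ => (2 * k : ℤ) ≤ twiceExcess C σ i + 1).card : ℝ) * z ^ k ≤
      Real.exp (72 * Δ * ((Δ - 1 : ℕ) : ℝ) ^ (2 * i + 1) / n * z) * (matchings n Δ).card := by
  rcases (matchings n Δ).eq_empty_or_nonempty with h0 | ⟨τ, hτ⟩
  · simp [h0]
  have hn0 : 0 < n := by
    rcases Nat.eq_zero_or_pos n with rfl | h
    · omega
    · exact h
  have hn0' : (0 : ℝ) < n := by exact_mod_cast hn0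
  set q : ℝ := ((Δ - 1 : ℕ) : ℝ) with hq
  -- At most 6Δq^(i+1) points lie in discovered cells, and by `hn` at least Δn/2 partners are
  -- available.
  set p : ℝ := 12 * q ^ (i + 1) / n with hp
  have hp0 : 0 ≤ p := by positivity
  have hext : extensions ∅ τ = matchings n Δ := by
    ext σ; simp [mem_extensions]
  have hpn : ((Δ * (6 * (Δ - 1) ^ (i + 1)) : ℕ) : ℝ) ≤
      p * (Δ * n - 2 * (Δ * (6 * (Δ - 1) ^ i) : ℕ) - 1) := by
    have h1 : ((24 * Δ * (Δ - 1) ^ i + 2 : ℕ) : ℝ) ≤ (Δ * n : ℕ) := by exact_mod_cast hn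
    have h2 : ((Δ * (6 * (Δ - 1) ^ (i + 1)) : ℕ) : ℝ) = p * (Δ * n / 2) := by
      rw [hp, hq]
      push_cast
      field_simp
      ring
    rw [h2]
    refine mul_le_mul_of_nonneg_left ?_ hp0
    push_cast at h1 ⊢
    linarith
  have h := IsExplored.card_mul_pow_le (k := k) hΔ hC hz hp0 hpn (Δ * (6 * (Δ - 1) ^ i)) 0 0 ∅ τ
    ⟨hτ, by simp, by simp⟩ (by simp) (by simp [hC]) (by simp)
  rw [hext, pow_zero, one_mul] at h
  refine h.trans (mul_le_mul_of_nonneg_right ?_ (Nat.cast_nonneg _))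
  calc (1 + p * (z - 1)) ^ (Δ * (6 * (Δ - 1) ^ i))
      ≤ Real.exp (p * z) ^ (Δ * (6 * (Δ - 1) ^ i)) := by
        have : 0 ≤ p * (z - 1) := mul_nonneg hp0 (by linarith)
        refine pow_le_pow_left₀ (by linarith) ?_ _
        have := Real.add_one_le_exp (p * z)
        nlinarith
    _ = _ := by
        rw [← Real.exp_nat_mul]
        congr 1
        rw [hp, hq]
        push_cast
        ring

end

/-! ### Distances in the multigraph: pure cells are distinguishers. -/

lemma SimpleGraph.add_one_le_edist_of_forall_adj {V : Type*} {H : SimpleGraph V} {u b : V}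
    {m : ℕ∞} (hub : u ≠ b) (h : ∀ z, H.Adj u z → m ≤ H.edist z b) : m + 1 ≤ H.edist u b := by
  by_cases ht : H.edist u b = ⊤
  · rw [ht]; exact le_top
  · obtain ⟨p, hp⟩ := SimpleGraph.exists_walk_of_edist_ne_top ht
    rw [← hp]
    cases p with
    | nil => exact absurd rfl hub
    | cons hz p =>
      rw [SimpleGraph.Walk.length_cons]
      push_cast
      gcongr
      exact (h _ hz).trans (SimpleGraph.edist_le p)

section
variable {n Δ : ℕ} {C : Finset (Fin n)} {c : Configuration n Δ} {i : ℕ} {v w y u b : Fin n}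

/-- The simple graph of pairs of distinct adjacent cells. -/
abbrev Configuration.simpleGraph (c : Configuration n Δ) : SimpleGraph (Fin n) :=
  SimpleGraph.fromRel c.multigraph.Adj

lemma Configuration.multigraph_adj_iff : c.multigraph.Adj u y ↔ ∃ j, (c.1 (u, j)).1 = y := by
  constructor
  · rintro ⟨e, x, -, rfl, rfl⟩
    exact ⟨x.2, rfl⟩
  · rintro ⟨j, rfl⟩
    exact ⟨_, (u, j), rfl, rfl, rfl⟩

lemma Configuration.simpleGraph_adj_iff :
    c.simpleGraph.Adj u y ↔ u ≠ y ∧ ∃ j, (c.1 (u, j)).1 = y := by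
  rw [SimpleGraph.fromRel_adj, c.multigraph.adj_comm y u, or_self, c.multigraph_adj_iff]

lemma Configuration.le_edist_of_notMem_fullBall (hb : b ∈ C) (hu : u ∉ fullBall C c.1 i) :
    (i + 1 : ℕ∞) ≤ c.simpleGraph.edist u b := by
  have hub : u ≠ b := fun h =>
    hu (knownBall_mono (C := C) (A := .univ) (Nat.zero_le i) (h ▸ hb))
  induction i generalizing u with
  | zero => exact SimpleGraph.add_one_le_edist_of_forall_adj hub fun _ _ => by simp
  | succ i ih =>
    refine SimpleGraph.add_one_le_edist_of_forall_adj hub fun z hz => ?_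
    obtain ⟨-, j, rfl⟩ := c.simpleGraph_adj_iff.1 hz
    have hz' : (c.1 (u, j)).1 ∉ fullBall C c.1 i := fun h => hu <| by
      have := fst_apply_mem_fullBall_succ h
      rwa [c.2.1] at this
    have := ih hz' fun h => hz' (h ▸ knownBall_mono (C := C) (A := .univ) (Nat.zero_le i) hb)
    simpa using this

/-- A path from a pure cell to the far root b starts through its unique edge into the ball, to a
pure parent where induction applies, or leaves the ball, where every cell is already far from both
roots. -/
lemma Configuration.edist_of_mem_pureSphere (hvw : 2 ≤ c.simpleGraph.edist v w)
    (hy : y ∈ pureSphere {v, w} c.1 i) : ∃ a b, (a = v ∧ b = w ∨ a = w ∧ b = v) ∧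
      c.simpleGraph.edist y a ≤ i ∧ (i + 2 : ℕ∞) ≤ c.simpleGraph.edist y b := by
  induction i generalizing y with
  | zero =>
    simp only [pureSphere, Finset.mem_insert, Finset.mem_singleton] at hy
    obtain rfl | rfl := hy
    · exact ⟨y, w, Or.inl ⟨rfl, rfl⟩, by simp, by simpa using hvw⟩
    · exact ⟨y, v, Or.inr ⟨rfl, rfl⟩, by simp, by simpa [SimpleGraph.edist_comm] using hvw⟩
  | succ i ih =>
    rw [pureSphere, Finset.mem_filter] at hy
    obtain ⟨hyB, hdeg, hpure⟩ := hy
    obtain ⟨j, hj⟩ := degInto_pos.1 (degInto_pos_of_mem_sdiff c.2.1 hyB)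
    have hj' := knownBall_subset_succ i hj
    obtain ⟨a, b, hab, h1, h2⟩ := ih (hpure j hj')
    have hyB' := (Finset.mem_sdiff.1 hyB).2
    have hb : b ∈ ({v, w} : Finset (Fin n)) := by
      rcases hab with ⟨-, rfl⟩ | ⟨-, rfl⟩ <;> simp
    refine ⟨a, b, hab, ?_, ?_⟩
    · have hadj : c.simpleGraph.Adj y (c.1 (y, j)).1 :=
        c.simpleGraph_adj_iff.2 ⟨fun h => hyB' (by rw [h]; exact hj), j, rfl⟩
      refine (SimpleGraph.edist_triangle (v := (c.1 (y, j)).1)).trans ?_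
      rw [SimpleGraph.edist_eq_one_iff_adj.2 hadj, add_comm]
      push_cast
      gcongr
    · have : ((i + 1 : ℕ) + 2 : ℕ∞) = (i + 2) + 1 := by push_cast; ring
      rw [this]
      refine SimpleGraph.add_one_le_edist_of_forall_adj
        (fun h => hyB' (h ▸ knownBall_mono (C := {v, w}) (A := .univ) (Nat.zero_le i) hb)) ?_
      intro z hz
      obtain ⟨-, j', rfl⟩ := c.simpleGraph_adj_iff.1 hz
      by_cases hz' : (c.1 (y, j')).1 ∈ fullBall {v, w} c.1 (i + 1)
      · rwa [Finset.card_le_one.1 hdeg.le j' (by simpa using hz') j (by simpa using hj')]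
      · have := c.le_edist_of_notMem_fullBall hb hz'
        push_cast at this
        rwa [add_assoc, one_add_one_eq_two] at this

lemma Configuration.card_pureSphere_le_ncard_distinguishers
    (hvw : 2 ≤ multigraphDist c.multigraph v w) :
    (pureSphere {v, w} c.1 i).card ≤ (distinguishers c.multigraph v w).ncard := by
  rw [← Set.ncard_coe_finset]
  refine Set.ncard_le_ncard ?_ (Set.toFinite _)
  intro y hy
  obtain ⟨a, b, hab, h1, h2⟩ := c.edist_of_mem_pureSphere hvw hy
  have h3 : c.simpleGraph.edist y a + 1 < c.simpleGraph.edist y b := by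
    refine lt_of_lt_of_le (lt_of_le_of_lt (add_le_add_left h1 1) ?_) h2
    exact_mod_cast Nat.lt_succ_self (i + 1)
  refine ⟨Set.mem_univ _, ?_⟩
  rcases hab with ⟨rfl, rfl⟩ | ⟨rfl, rfl⟩
  · exact Or.inl h3
  · exact Or.inr h3

lemma Configuration.two_le_multigraphDist (hvw : v ≠ w) (h : twiceExcess {v, w} c.1 0 < 2) :
    2 ≤ multigraphDist c.multigraph v w := by
  by_contra hlt
  have hne : ¬ c.simpleGraph.Adj v w := by
    intro hadj
    obtain ⟨-, j, hj⟩ := c.simpleGraph_adj_iff.1 hadj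
    rw [twiceExcess_zero, edgeCount] at h
    have h1 : Finset.card {(v, j), c.1 (v, j)} = 2 := Finset.card_pair (c.2.2 _).symm
    have h2 : ({(v, j), c.1 (v, j)} : Finset _) ⊆ Finset.univ.filter fun x : Fin n × Fin Δ =>
        x.1 ∈ ({v, w} : Finset (Fin n)) ∧ (c.1 x).1 ∈ ({v, w} : Finset (Fin n)) := by
      intro x hx
      simp only [Finset.mem_insert, Finset.mem_singleton] at hx
      rcases hx with rfl | rfl
      · simp [hj]
      · simp [hj, c.2.1]
    have := Finset.card_le_card h2
    omega
  have h1 : (1 + 1 : ℕ∞) ≤ c.simpleGraph.edist v w :=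
    SimpleGraph.add_one_le_edist_of_forall_adj hvw fun z hz => by
      rw [Order.one_le_iff_pos]
      exact SimpleGraph.edist_pos_of_ne fun h => hne (h ▸ hz)
  rw [one_add_one_eq_two] at h1
  exact hlt h1

end

/-! ### Growth of the pure spheres under bounds on the excess. -/

section
variable {n Δ : ℕ} {C : Finset (Fin n)} {σ : Equiv.Perm (Fin n × Fin Δ)} {a b q : ℝ} {s r : ℕ}

/-- Solves the growth recursion by charging every unit of `twiceExcess` up to radius s at the weight
q^(s-1) of the earliest possible loss. -/
lemma pow_mul_le_card_pureSphere (hσ : ∀ x, σ (σ x) = x) (hΔ : 3 ≤ Δ) (hC : C.card = 2)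
    (hs : 1 ≤ s) : ((Δ - 1 : ℤ)) ^ s * (2 * Δ - twiceExcess C σ s) ≤
      (Δ - 1) * (pureSphere C σ s).card := by
  have hq : (2 : ℤ) ≤ Δ - 1 := by omega
  induction s, hs using Nat.le_induction with
  | base =>
    have h := card_pureSphere_one_ge (C := C) hσ
    rw [hC] at h
    rw [pow_one]
    push_cast at h
    exact mul_le_mul_of_nonneg_left (by linarith) (by linarith)
  | succ s hs ih =>
    obtain ⟨s, rfl⟩ := Nat.exists_eq_add_of_le' hs
    have h := card_pureSphere_succ_ge (C := C) hσ s
    have hm := twiceExcess_mono (C := C) hσ (Nat.le_succ (s + 1))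
    have hqs : (1 : ℤ) ≤ (Δ - 1) ^ (s + 1) := one_le_pow₀ (by linarith)
    rw [pow_succ, mul_comm _ ((Δ : ℤ) - 1), mul_assoc]
    refine mul_le_mul_of_nonneg_left ?_ (by linarith)
    have : twiceExcess C σ (s + 1 + 1) - twiceExcess C σ (s + 1) ≤
        (Δ - 1) ^ (s + 1) * (twiceExcess C σ (s + 1 + 1) - twiceExcess C σ (s + 1)) :=
      le_mul_of_one_le_left (by simpa using hm) hqs
    simp only [Nat.succ_eq_add_one] at *
    linarith

lemma card_pureSphere_ge (hσ : ∀ x, σ (σ x) = x) (hΔ : 3 ≤ Δ) (hC : C.card = 2) (hs : 1 ≤ s)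
    (hq : q = Δ - 1) (ha : 0 ≤ a) (hb : 0 ≤ b) (hsE : twiceExcess C σ s ≤ 4) (hsr : s ≤ r)
    (hE : ∀ j, s < j → j ≤ r → (twiceExcess C σ j : ℝ) ≤ a * q ^ (2 * j) + b) :
    q ^ r * (2 - a * q ^ 2 * q ^ r - 2 * b / q ^ s) ≤ q * (pureSphere C σ r).card := by
  have hq2 : 2 ≤ q := by
    have : (3 : ℝ) ≤ Δ := by exact_mod_cast hΔ
    linarith
  suffices h : 2 * q ^ r - a * q ^ 2 * (q ^ r) ^ 2 - 2 * b * q ^ r / q ^ s + 2 * b ≤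
      q * (pureSphere C σ r).card by
    refine le_trans ?_ h
    rw [← sub_nonneg]
    ring_nf
    positivity
  induction r, hsr using Nat.le_induction with
  | base =>
    have h := pow_mul_le_card_pureSphere (C := C) hσ hΔ hC hs
    have h' : (q : ℝ) ^ s * (2 * Δ - (twiceExcess C σ s : ℝ)) ≤ q * (pureSphere C σ s).card := by
      rw [hq]
      exact_mod_cast h
    have h4 : ((twiceExcess C σ s : ℤ) : ℝ) ≤ 4 := by exact_mod_cast hsE
    have h5 : 2 * q ^ s ≤ (q : ℝ) ^ s * (2 * Δ - (twiceExcess C σ s : ℝ)) := by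
      rw [mul_comm]
      refine mul_le_mul_of_nonneg_left ?_ (by positivity)
      linarith
    have h6 : 2 * b * q ^ s / q ^ s = 2 * b := by
      field_simp
    have h7 : 0 ≤ a * q ^ 2 * (q ^ s) ^ 2 := by positivity
    linarith
  | succ r hr ih =>
    have ih := ih fun j h1 h2 => hE j h1 (by omega)
    obtain ⟨r, rfl⟩ := Nat.exists_eq_add_of_le' (hs.trans hr)
    have h := card_pureSphere_succ_ge (C := C) hσ r
    have h' : q * ((pureSphere C σ (r + 1)).card : ℝ) + (twiceExcess C σ (r + 1) : ℝ) ≤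
        (pureSphere C σ (r + 2)).card + (twiceExcess C σ (r + 2) : ℝ) := by
      rw [hq]
      exact_mod_cast h
    have h0 : (0 : ℝ) ≤ twiceExcess C σ (r + 1) := by exact_mod_cast twiceExcess_nonneg hσ _
    have h1 := hE (r + 2) (by omega) le_rfl
    have h2 : q * ((pureSphere C σ (r + 1)).card : ℝ) - (a * q ^ (2 * (r + 2)) + b) ≤
        (pureSphere C σ (r + 2)).card := by linarith
    have h3 := mul_le_mul_of_nonneg_left h2 (by linarith : 0 ≤ q)
    have h4 := mul_le_mul_of_nonneg_left ih (by linarith : 0 ≤ q)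
    set Q := q ^ (r + 1) with hQ
    have e1 : q ^ (r + 1 + 1) = q * Q := by rw [hQ]; ring
    have e2 : q ^ (2 * (r + 2)) = q ^ 2 * Q ^ 2 := by rw [hQ]; ring
    rw [e2] at h3
    rw [e1]
    have h5 : 0 ≤ a * q ^ 3 * Q ^ 2 * (q - 2) := mul_nonneg (by positivity) (by linarith)
    have h6 : 0 ≤ b * (q - 2) := mul_nonneg hb (by linarith)
    have e3 : 2 * b * (q * Q) / q ^ s = q * (2 * b * Q / q ^ s) := by ring
    rw [e3]
    refine le_trans ?_ h3
    nlinarith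

end

/-! ### Tail bounds for the uniform configuration. -/

instance {n Δ : ℕ} : DiscreteMeasurableSpace (Configuration n Δ) := ⟨fun _ => trivial⟩

instance {n Δ : ℕ} : Finite (Configuration n Δ) := by
  unfold Configuration
  infer_instance

section
variable {n Δ : ℕ}

lemma Configuration.nonempty (h : Even (Δ * n)) : Nonempty (Configuration n Δ) := by
  obtain ⟨m, hm⟩ := h
  have e : Fin n × Fin Δ ≃ Fin m ⊕ Fin m := Fintype.equivOfCardEq (by simp [mul_comm n, hm])
  refine ⟨(e.trans (Equiv.sumComm _ _)).trans e.symm, fun x => ?_, fun x h => ?_⟩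
  · simp
  · have h' : Sum.swap (e x) = e x := by
      simpa [Equiv.symm_apply_eq] using h
    cases he : e x <;> simp [he] at h'

lemma isProbabilityMeasure_uniformConfiguration (h : Even (Δ * n)) :
    IsProbabilityMeasure (uniformConfiguration n Δ) := by
  have := Configuration.nonempty h
  exact isProbabilityMeasure_uniformOn Set.finite_univ Set.univ_nonempty

lemma uniformConfiguration_real (P : Equiv.Perm (Fin n × Fin Δ) → Prop) [DecidablePred P] :
    (uniformConfiguration n Δ).real {c | P c.1} =
      ((matchings n Δ).filter P).card / (matchings n Δ).card := by
  have := Fintype.ofFinite (Configuration n Δ)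
  have hinj : Function.Injective fun c : Configuration n Δ => c.1 := Subtype.val_injective
  have h1 : ∀ Q : Equiv.Perm (Fin n × Fin Δ) → Prop, [DecidablePred Q] →
      {c : Configuration n Δ | Q c.1}.ncard = ((matchings n Δ).filter Q).card := by
    intro Q _
    rw [← Set.ncard_coe_finset, ← Set.ncard_image_of_injective _ hinj]
    congr 1
    ext σ
    simp only [Set.mem_image, Finset.coe_filter, mem_matchings, Set.mem_ofPred_eq]
    constructor
    · rintro ⟨c, hc, rfl⟩
      exact ⟨c.2, hc⟩
    · rintro ⟨h, hσ⟩
      exact ⟨⟨σ, h⟩, hσ, rfl⟩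
  have h2 := h1 (fun _ => True)
  rw [Finset.filter_true] at h2
  rw [uniformConfiguration, measureReal_def, uniformOn_univ, Measure.count_apply .of_discrete,
    ENNReal.toReal_div, ← h1, ← h2]
  congr 1
  · rw [← (Set.toFinite _).cast_ncard_eq, ENat.toENNReal_coe, ENNReal.toReal_natCast]
  · have h3 : {c : Configuration n Δ | True} = Set.univ := Set.eq_univ_of_forall fun _ => trivial
    rw [h3, Set.ncard_univ, Nat.card_eq_fintype_card]
    simp

/-- Exponential tail bound for the excess of the ball of radius `i` of a random configuration. -/
lemma uniformConfiguration_real_twiceExcess_le {C : Finset (Fin n)} {i : ℕ} (hΔ : 3 ≤ Δ)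
    (hC : C.card = 2) (k : ℕ) {z : ℝ} (hz : 1 ≤ z) (hn : 24 * Δ * (Δ - 1) ^ i + 2 ≤ Δ * n) :
    (uniformConfiguration n Δ).real {c | (2 * k : ℤ) ≤ twiceExcess C c.1 i + 1} ≤
      Real.exp (72 * Δ * ((Δ - 1 : ℕ) : ℝ) ^ (2 * i + 1) / n * z) / z ^ k := by
  rw [uniformConfiguration_real fun σ => (2 * k : ℤ) ≤ twiceExcess C σ i + 1]
  have h := card_twiceExcess_ge_mul_pow_le hΔ hC k hz hn
  rcases (matchings n Δ).card.eq_zero_or_pos with h0 | h0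
  · rw [h0]
    simp only [Nat.cast_zero, div_zero]
    positivity
  · have h0' : (0 : ℝ) < (matchings n Δ).card := by exact_mod_cast h0
    rwa [div_le_div_iff₀ h0' (by positivity)]

/-- The choice z = 1/m, suited to small radii. The + 1 in the event makes its complement say
`twiceExcess` ≤ 2k - 2 without a parity argument. -/
lemma uniformConfiguration_real_twiceExcess_le_pow {C : Finset (Fin n)} {i : ℕ} (hΔ : 3 ≤ Δ)
    (hC : C.card = 2) (k : ℕ) (hn : 24 * Δ * (Δ - 1) ^ i + 2 ≤ Δ * n) {m : ℝ}
    (hm : m = 72 * Δ * ((Δ - 1 : ℕ) : ℝ) ^ (2 * i + 1) / n) (hm1 : m ≤ 1) :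
    (uniformConfiguration n Δ).real {c | (2 * k : ℤ) ≤ twiceExcess C c.1 i + 1} ≤ 3 * m ^ k := by
  have hn0 : 0 < n := by
    rcases Nat.eq_zero_or_pos n with rfl | h
    · omega
    · exact h
  have hq : 0 < Δ - 1 := by omega
  have hΔ0 : 0 < Δ := by omega
  have hm0 : 0 < m := by rw [hm]; positivity
  have h := uniformConfiguration_real_twiceExcess_le hΔ hC k (one_le_inv_iff₀.2 ⟨hm0, hm1⟩) hn
  rw [← hm, mul_inv_cancel₀ hm0.ne', inv_pow, div_inv_eq_mul] at h
  refine h.trans (mul_le_mul_of_nonneg_right ?_ (by positivity))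
  exact Real.exp_one_lt_d9.le.trans (by norm_num)

/-- The choice z = e, suited to radii where m may be large. -/
lemma uniformConfiguration_real_twiceExcess_le_exp {C : Finset (Fin n)} {i : ℕ} (hΔ : 3 ≤ Δ)
    (hC : C.card = 2) {k : ℕ} (hn : 24 * Δ * (Δ - 1) ^ i + 2 ≤ Δ * n) {m : ℝ}
    (hm : m = 72 * Δ * ((Δ - 1 : ℕ) : ℝ) ^ (2 * i + 1) / n) (hk : 3 * m + 4 * Real.log n ≤ k) :
    (uniformConfiguration n Δ).real {c | (2 * k : ℤ) ≤ twiceExcess C c.1 i + 1} ≤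
      ((n : ℝ) ^ 4)⁻¹ := by
  have hn0 : 0 < n := by
    rcases Nat.eq_zero_or_pos n with rfl | h
    · omega
    · exact h
  have hn0' : (0 : ℝ) < n := by exact_mod_cast hn0
  have hm0 : 0 ≤ m := by rw [hm]; positivity
  have h := uniformConfiguration_real_twiceExcess_le hΔ hC k (Real.one_le_exp zero_le_one) hn
  rw [← hm, ← Real.exp_nat_mul, ← Real.exp_sub] at h
  refine h.trans ?_
  have h4 : ((n : ℝ) ^ 4)⁻¹ = Real.exp (-(4 * Real.log n)) := by
    rw [Real.exp_neg]
    congr 1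
    rw [show (4 : ℝ) * Real.log n = (4 : ℕ) * Real.log n by norm_num, Real.exp_nat_mul,
      Real.exp_log hn0']
  rw [h4, Real.exp_le_exp]
  have h3 : Real.exp 1 ≤ 3 := Real.exp_one_lt_d9.le.trans (by norm_num)
  nlinarith

/-- An edge between v and w would already give excess at radius 0; the lower bound on n makes 3m ≤
1/2 there. -/
lemma uniformConfiguration_real_two_le_dist_ge (hΔ : 3 ≤ Δ) (hev : Even (Δ * n)) {v w : Fin n}
    (hvw : v ≠ w) (hn : 432 * Δ * (Δ - 1) ≤ n) :
    1 / 2 ≤ (uniformConfiguration n Δ).real {c | 2 ≤ multigraphDist c.multigraph v w} := by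
  have := isProbabilityMeasure_uniformConfiguration hev
  have hq : 0 < Δ - 1 := by omega
  have hn0 : 0 < n := lt_of_lt_of_le (by positivity) hn
  have hn0' : (0 : ℝ) < n := by exact_mod_cast hn0
  have hnR : (432 * Δ * ((Δ - 1 : ℕ) : ℝ)) ≤ n := by exact_mod_cast hn
  have hm1 : 72 * (Δ : ℝ) * ((Δ - 1 : ℕ) : ℝ) ^ (2 * 0 + 1) / n ≤ 1 / 6 := by
    rw [div_le_iff₀ hn0']
    norm_num
    linarith
  have h := uniformConfiguration_real_twiceExcess_le_pow (n := n) (C := {v, w}) (i := 0) hΔ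
    (Finset.card_pair hvw) 1 (by
      have : Δ * 432 ≤ Δ * n := Nat.mul_le_mul_left _ (by nlinarith)
      rw [pow_zero]
      omega) rfl (hm1.trans (by norm_num))
  have hsub : {c : Configuration n Δ | (2 * (1 : ℕ) : ℤ) ≤ twiceExcess {v, w} c.1 0 + 1}ᶜ ⊆
      {c | 2 ≤ multigraphDist c.multigraph v w} := by
    intro c hc
    refine c.two_le_multigraphDist hvw ?_
    simp only [Set.mem_compl_iff, Set.mem_ofPred_eq] at hc
    push_cast at hc
    omega
  refine le_trans ?_ (measureReal_mono hsub)
  rw [probReal_compl_eq_one_sub .of_discrete]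
  rw [pow_one] at h
  linarith

end

/-! ### Choice of radii and conclusion. -/

section
variable {n Δ : ℕ}

/-- If the excess is at most `2` at radius `s` and of lower order between `s` and `r`, then the
distinguishers of two nonadjacent cells are many. -/
lemma Configuration.ncard_distinguishers_gt {K : ℕ} {c : Configuration n Δ} {v w : Fin n}
    {s r : ℕ} {k : ℕ → ℕ} (hΔ : 3 ≤ Δ) (hvw : v ≠ w)
    (hK : K = 864 * Δ * (Δ - 1) ^ 3) (hn : 0 < n) (hs : 1 ≤ s) (hsr : s ≤ r)
    (hr : (Δ - 1) ^ r * K ≤ n) (hr' : n < (Δ - 1) ^ (r + 1) * K)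
    (hk : ∀ j, (k j : ℝ) ≤
      3 * (72 * Δ * ((Δ - 1 : ℕ) : ℝ) ^ (2 * j + 1) / n) + 4 * Real.log n + 1)
    (hlog : 3 * K * ((Δ - 1 : ℕ) : ℝ) ^ 2 ≤ Real.log n)
    (hlog' : 4 * (8 * Real.log n + 1) ≤ ((Δ - 1 : ℕ) : ℝ) ^ s)
    (hsE : twiceExcess {v, w} c.1 s + 1 < 2 * (3 : ℕ))
    (hE : ∀ j, s < j → j ≤ r → twiceExcess {v, w} c.1 j + 1 < 2 * k j)
    (hdist : 2 ≤ multigraphDist c.multigraph v w) :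
    3 * (n : ℝ) / Real.log n < ((distinguishers c.multigraph v w).ncard : ℝ) := by
  set q : ℝ := ((Δ - 1 : ℕ) : ℝ) with hq
  have hn' : (0 : ℝ) < n := by exact_mod_cast hn
  have hΔ' : (0 : ℝ) < Δ := by exact_mod_cast (by omega : 0 < Δ)
  have hq0 : 0 < q := by rw [hq]; exact_mod_cast (by omega : 0 < Δ - 1)
  have hq' : q = Δ - 1 := by rw [hq, Nat.cast_sub (by omega)]; simp
  have hK' : (K : ℝ) = 864 * Δ * q ^ 3 := by rw [hK]; push_cast; rfl
  have hK0 : (0 : ℝ) < K := by rw [hK']; positivity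
  have hlog0 : 0 < Real.log n := lt_of_lt_of_le (by positivity) hlog
  have hrR : q ^ r * K ≤ n := by rw [hq]; exact_mod_cast hr
  have hrR' : n < q ^ (r + 1) * K := by rw [hq]; exact_mod_cast hr'
  -- Here a and b come from `twiceExcess` ≤ 2k - 2 and the bound `hk`. The constant K is 2 · 432Δq ·
  -- q^2, so that the two losses below are at most 1/2 each.
  have hmain := card_pureSphere_ge (C := {v, w}) (σ := c.1) (a := 432 * Δ * q / n)
    (b := 8 * Real.log n + 1) c.2.1 hΔ (Finset.card_pair hvw) hs hq' (by positivity)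
    (by positivity) (by push_cast at hsE; omega) hsr (by
      intro j h1 h2
      have h3 : ((twiceExcess {v, w} c.1 j + 1 : ℤ) : ℝ) + 1 ≤ (2 * k j : ℤ) := by
        exact_mod_cast Int.add_one_le_iff.2 (hE j h1 h2)
      push_cast at h3
      have h4 := hk j
      have h5 : 432 * Δ * q / n * q ^ (2 * j) = 6 * (72 * Δ * q ^ (2 * j + 1) / n) := by ring
      rw [h5]
      linarith)
  have h1 : 432 * Δ * q / n * q ^ 2 * q ^ r ≤ 1 / 2 := by
    have : 432 * Δ * q / n * q ^ 2 * q ^ r = (q ^ r * K) / n / 2 := by rw [hK']; ring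
    rw [this]
    have := (div_le_one hn').2 hrR
    linarith
  have h2 : 2 * (8 * Real.log n + 1) / q ^ s ≤ 1 / 2 := by
    rw [div_le_iff₀ (by positivity)]
    linarith
  have h3 : q ^ r ≤ q * (pureSphere {v, w} c.1 r).card := by
    refine le_trans ?_ hmain
    have : 0 < q ^ r := by positivity
    nlinarith
  have h4 : ((pureSphere {v, w} c.1 r).card : ℝ) ≤ (distinguishers c.multigraph v w).ncard := by
    exact_mod_cast c.card_pureSphere_le_ncard_distinguishers hdist
  refine lt_of_lt_of_le ?_ h4
  rw [div_lt_iff₀ hlog0]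
  have h5 : (n : ℝ) < (pureSphere {v, w} c.1 r).card * (K * q ^ 2) := by
    refine hrR'.trans_le ?_
    calc q ^ (r + 1) * K = q ^ r * (K * q) := by ring
      _ ≤ q * (pureSphere {v, w} c.1 r).card * (K * q) := by gcongr
      _ = _ := by ring
  calc 3 * (n : ℝ) < 3 * ((pureSphere {v, w} c.1 r).card * (K * q ^ 2)) := by linarith
    _ = (pureSphere {v, w} c.1 r).card * (3 * K * q ^ 2) := by ring
    _ ≤ _ := by gcongr

lemma uniformConfiguration_real_few_distinguishers_le {K : ℕ} {v w : Fin n} (hΔ : 3 ≤ Δ)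
    (hev : Even (Δ * n)) (hvw : v ≠ w) (hK : K = 864 * Δ * (Δ - 1) ^ 3)
    (hKn : K ^ 2 ≤ n) (hqn : (Δ - 1) ^ 12 ≤ n)
    (hlog : 3 * K * ((Δ - 1 : ℕ) : ℝ) ^ 2 ≤ Real.log n)
    (hlog' : 4 * ((Δ - 1 : ℕ) : ℝ) * (8 * Real.log n + 1) ≤ (n : ℝ) ^ (1 / 12 : ℝ)) :
    (uniformConfiguration n Δ).real {c | 2 ≤ multigraphDist c.multigraph v w ∧
      ¬ 3 * (n : ℝ) / Real.log n < ((distinguishers c.multigraph v w).ncard : ℝ)} ≤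
      (3 * (K : ℝ) ^ 3 + 1) * (√n / (n : ℝ) ^ 3) := by
  have := isProbabilityMeasure_uniformConfiguration hev
  have hq2 : 2 ≤ Δ - 1 := by omega
  have hq0 : 0 < Δ - 1 := by omega
  have hΔ0 : 0 < Δ := by omega
  have hK0 : 0 < K := by rw [hK]; positivity
  have hn : 0 < n := lt_of_lt_of_le (by positivity) hKn
  have hn' : (0 : ℝ) < n := by exact_mod_cast hn
  have hn1 : (1 : ℝ) ≤ n := by exact_mod_cast hn
  -- Thus q^s is n^(1/12) up to a factor q: large compared with log n, yet q^(6s) ≤ √n, which makes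
  -- the cube of m at radius s of order n^(-5/2).
  set s := Nat.log ((Δ - 1) ^ 12) n with hs_def
  set r := Nat.log (Δ - 1) (n / K) with hr_def
  have hb12 : 1 < (Δ - 1) ^ 12 := Nat.one_lt_pow (by norm_num) (by omega)
  have hKn' : K ≤ n := (Nat.le_self_pow (by norm_num) K).trans hKn
  have hs : 1 ≤ s := Nat.log_pos hb12 hqn
  have hs12 : (Δ - 1) ^ (12 * s) ≤ n := by
    rw [pow_mul]
    exact Nat.pow_log_le_self _ hn.ne'
  have hs12' : n < ((Δ - 1) ^ (s + 1)) ^ 12 := by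
    rw [← pow_mul, mul_comm (s + 1), pow_mul]
    exact Nat.lt_pow_succ_log_self hb12 n
  have hr : (Δ - 1) ^ r * K ≤ n := by
    rw [← Nat.le_div_iff_mul_le hK0]
    exact Nat.pow_log_le_self _ (Nat.div_pos hKn' hK0).ne'
  have hr' : n < (Δ - 1) ^ (r + 1) * K := by
    rw [← Nat.div_lt_iff_lt_mul hK0]
    exact Nat.lt_pow_succ_log_self (by omega) _
  have hs2 : ((Δ - 1) ^ s) ^ 2 ≤ n := by
    rw [← pow_mul]
    exact (Nat.pow_le_pow_right hq0 (by omega)).trans hs12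
  have hsr : s ≤ r := by
    by_contra! hlt
    have h1 : (Δ - 1) ^ (r + 1) ≤ (Δ - 1) ^ s := Nat.pow_le_pow_right hq0 hlt
    have h2 : n < (Δ - 1) ^ s * K := hr'.trans_le (Nat.mul_le_mul_right _ h1)
    have h3 : n ^ 2 < ((Δ - 1) ^ s * K) ^ 2 := Nat.pow_lt_pow_left h2 (by norm_num)
    rw [mul_pow] at h3
    have h4 : ((Δ - 1) ^ s) ^ 2 * K ^ 2 ≤ n * n := Nat.mul_le_mul hs2 hKn
    nlinarith
  have hrn : r ≤ n := by
    have h1 : r < (Δ - 1) ^ r := Nat.lt_pow_self (by omega)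
    nlinarith
  have hcond : ∀ j ≤ r, 24 * Δ * (Δ - 1) ^ j + 2 ≤ Δ * n := by
    intro j hj
    have h1 : (Δ - 1) ^ j ≤ (Δ - 1) ^ r := Nat.pow_le_pow_right hq0 hj
    have h2 : 864 ≤ K := by
      rw [hK, mul_assoc]
      exact Nat.le_mul_of_pos_right _ (by positivity)
    have h3 : (Δ - 1) ^ r * 864 ≤ n := (Nat.mul_le_mul_left _ h2).trans hr
    have h4 : Δ * (24 * (Δ - 1) ^ j + 2) ≤ Δ * n := by
      refine Nat.mul_le_mul_left _ ?_
      have : 1 ≤ (Δ - 1) ^ r := Nat.one_le_pow _ _ hq0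
      omega
    nlinarith
  set q : ℝ := ((Δ - 1 : ℕ) : ℝ) with hq
  have hq0' : 0 < q := by rw [hq]; exact_mod_cast hq0
  have hq1' : 1 ≤ q := by rw [hq]; exact_mod_cast hq0
  have hK' : (K : ℝ) = 864 * Δ * q ^ 3 := by rw [hK]; push_cast; rfl
  have hΔ' : (0 : ℝ) < Δ := by exact_mod_cast hΔ0
  have hK72 : 72 * Δ * q ≤ K := by
    rw [hK']
    have h1 : q ≤ q ^ 3 := le_self_pow₀ hq1' (by norm_num)
    nlinarith [mul_pos hΔ' hq0', mul_le_mul_of_nonneg_left h1 hΔ'.le]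
  have hlogs : 4 * (8 * Real.log n + 1) ≤ q ^ s := by
    have h1 : (n : ℝ) ^ (1 / 12 : ℝ) ≤ q ^ (s + 1) := by
      have h2 : (n : ℝ) ≤ (q ^ (s + 1)) ^ 12 := by rw [hq]; exact_mod_cast hs12'.le
      calc (n : ℝ) ^ (1 / 12 : ℝ) ≤ ((q ^ (s + 1)) ^ 12) ^ (1 / 12 : ℝ) := by gcongr
        _ = q ^ (s + 1) := by
          rw [← Real.rpow_natCast, ← Real.rpow_mul (by positivity)]
          norm_num
    have h3 := hlog'.trans h1
    rw [pow_succ] at h3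
    nlinarith
  set m : ℕ → ℝ := fun j => 72 * Δ * q ^ (2 * j + 1) / n with hm
  set k : ℕ → ℕ := fun j => ⌈3 * m j + 4 * Real.log n⌉₊ with hk
  have hlog0 : 0 ≤ Real.log n := Real.log_nonneg hn1
  have hm0 : ∀ j, 0 ≤ m j := fun j => by rw [hm]; positivity
  have hqs2 : (q ^ s) ^ 2 ≤ √n := by
    refine Real.le_sqrt_of_sq_le ?_
    rw [← pow_mul, ← pow_mul, hq]
    exact_mod_cast (Nat.pow_le_pow_right hq0 (by omega)).trans hs12
  have hqs6 : (q ^ s) ^ 6 ≤ √n := by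
    refine Real.le_sqrt_of_sq_le ?_
    rw [← pow_mul, ← pow_mul, hq]
    exact_mod_cast (Nat.pow_le_pow_right hq0 (by omega)).trans hs12
  have hmK : m s ≤ K * (q ^ s) ^ 2 / n := by
    rw [hm]
    have : 72 * Δ * q ^ (2 * s + 1) = 72 * Δ * q * (q ^ s) ^ 2 := by ring
    simp only [this]
    gcongr
  have hm1 : m s ≤ 1 := by
    refine hmK.trans ((div_le_one hn').2 ?_)
    have h1 : (K : ℝ) ≤ √n := Real.le_sqrt_of_sq_le (by exact_mod_cast hKn)
    calc (K : ℝ) * (q ^ s) ^ 2 ≤ √n * √n := by gcongr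
      _ = n := Real.mul_self_sqrt hn'.le
  have hs_tail : (uniformConfiguration n Δ).real
      {c | (2 * (3 : ℕ) : ℤ) ≤ twiceExcess {v, w} c.1 s + 1} ≤
        3 * (K : ℝ) ^ 3 * (√n / (n : ℝ) ^ 3) := by
    refine (uniformConfiguration_real_twiceExcess_le_pow hΔ (Finset.card_pair hvw) 3
      (hcond s hsr) (m := m s) rfl hm1).trans ?_
    calc 3 * m s ^ 3 ≤ 3 * (K * (q ^ s) ^ 2 / n) ^ 3 := by
          have := hm0 s
          gcongr
      _ = 3 * (K : ℝ) ^ 3 * ((q ^ s) ^ 6 / (n : ℝ) ^ 3) := by ring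
      _ ≤ _ := by gcongr
  have hj_tail : ∀ j ∈ Finset.Ioc s r, (uniformConfiguration n Δ).real
      {c | (2 * (k j : ℕ) : ℤ) ≤ twiceExcess {v, w} c.1 j + 1} ≤ ((n : ℝ) ^ 4)⁻¹ := fun j hj =>
    uniformConfiguration_real_twiceExcess_le_exp hΔ (Finset.card_pair hvw)
      (hcond j (Finset.mem_Ioc.1 hj).2) (m := m j) rfl (Nat.le_ceil _)
  have hsub : {c : Configuration n Δ | 2 ≤ multigraphDist c.multigraph v w ∧
      ¬ 3 * (n : ℝ) / Real.log n < ((distinguishers c.multigraph v w).ncard : ℝ)} ⊆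
      {c | (2 * (3 : ℕ) : ℤ) ≤ twiceExcess {v, w} c.1 s + 1} ∪
        ⋃ j ∈ Finset.Ioc s r, {c | (2 * (k j : ℕ) : ℤ) ≤ twiceExcess {v, w} c.1 j + 1} := by
    rintro c ⟨hdist, hc⟩
    by_contra hnot
    simp only [Set.mem_union, Set.mem_iUnion, Set.mem_ofPred_eq, not_or, not_exists, not_le,
      Finset.mem_Ioc] at hnot
    refine hc (c.ncard_distinguishers_gt hΔ hvw hK hn hs hsr hr hr' (k := k) (fun j => ?_) hlog
      hlogs hnot.1 (fun j h1 h2 => hnot.2 j ⟨h1, h2⟩) hdist)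
    have := hm0 j
    exact (Nat.ceil_lt_add_one (by positivity)).le
  refine (measureReal_mono hsub).trans ((measureReal_union_le _ _).trans ?_)
  rw [add_mul]
  refine add_le_add hs_tail ((measureReal_biUnion_finset_le _ _).trans
    ((Finset.sum_le_sum hj_tail).trans ?_))
  rw [Finset.sum_const, nsmul_eq_mul, Nat.card_Ioc, one_mul]
  have h1 : ((r - s : ℕ) : ℝ) ≤ n := by exact_mod_cast (Nat.sub_le r s).trans hrn
  calc ((r - s : ℕ) : ℝ) * ((n : ℝ) ^ 4)⁻¹ ≤ n * ((n : ℝ) ^ 4)⁻¹ := by gcongr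
    _ = 1 / (n : ℝ) ^ 3 := by field_simp
    _ ≤ √n / (n : ℝ) ^ 3 := by
      gcongr
      exact Real.one_le_sqrt.2 hn1

end

theorem mainTheorem2 (Δ : ℕ) (hΔ : 3 ≤ Δ) :
    ∃ err : ℕ → ℝ, Asymptotics.IsLittleO atTop err (fun n : ℕ => ((n : ℝ) ^ 2)⁻¹) ∧
      ∀ n : ℕ, Even (Δ * n) → ∀ v w : Fin n, v ≠ w →
        1 - err n ≤
          (ProbabilityTheory.cond (uniformConfiguration n Δ)
            {c | 2 ≤ multigraphDist c.multigraph v w}).real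
            {c | 3 * (n : ℝ) / Real.log n < ((distinguishers c.multigraph v w).ncard : ℝ)} := by
  obtain ⟨K, hK⟩ : ∃ K, K = 864 * Δ * (Δ - 1) ^ 3 := ⟨_, rfl⟩
  have hlog : Tendsto (fun n : ℕ => Real.log n) atTop atTop :=
    Real.tendsto_log_atTop.comp tendsto_natCast_atTop_atTop
  have hrpow : ∀ᶠ n : ℕ in atTop,
      4 * ((Δ - 1 : ℕ) : ℝ) * (8 * Real.log n + 1) ≤ (n : ℝ) ^ (1 / 12 : ℝ) := by
    have ho : (fun n : ℕ => Real.log n) =o[atTop] fun n : ℕ => (n : ℝ) ^ (1 / 12 : ℝ) :=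
      (isLittleO_log_rpow_atTop (by norm_num)).comp_tendsto tendsto_natCast_atTop_atTop
    -- For log n ≥ 1, 4q(8 log n + 1) ≤ 36q log n.
    have hc : (0 : ℝ) < 1 / (36 * ((Δ - 1 : ℕ) : ℝ) + 1) := by positivity
    filter_upwards [ho.bound hc, hlog.eventually_ge_atTop 1] with n h1 h2
    rw [Real.norm_of_nonneg (by linarith), Real.norm_of_nonneg (by positivity), div_mul_eq_mul_div,
      one_mul, le_div_iff₀ (by positivity)] at h1
    have h3 : (0 : ℝ) ≤ ((Δ - 1 : ℕ) : ℝ) := Nat.cast_nonneg _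
    nlinarith
  obtain ⟨N, hN⟩ := eventually_atTop.1 (hrpow.and
    ((hlog.eventually_ge_atTop (3 * K * ((Δ - 1 : ℕ) : ℝ) ^ 2)).and
      ((eventually_ge_atTop (K ^ 2)).and ((eventually_ge_atTop ((Δ - 1) ^ 12)).and
        (eventually_ge_atTop (432 * Δ * (Δ - 1)))))))
  -- The factor 2 pays for conditioning on an event of probability at least 1/2. Below N the value 1
  -- makes the claim trivial, even if that event is null.
  refine ⟨fun n => if N ≤ n then 2 * ((3 * (K : ℝ) ^ 3 + 1) * (√n / (n : ℝ) ^ 3)) else 1, ?_, ?_⟩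
  · have hmain : (fun n : ℕ => √n / (n : ℝ) ^ 3) =o[atTop] fun n : ℕ => ((n : ℝ) ^ 2)⁻¹ := by
      rw [Asymptotics.isLittleO_iff_tendsto']
      · have ht : Tendsto (fun n : ℕ => (√(n : ℝ))⁻¹) atTop (nhds 0) :=
          (Real.tendsto_sqrt_atTop.comp tendsto_natCast_atTop_atTop).inv_tendsto_atTop
        refine ht.congr' ?_
        filter_upwards [eventually_gt_atTop 0] with n hn
        have hn' : (0 : ℝ) < n := by exact_mod_cast hn
        have hs : √(n : ℝ) ≠ 0 := (Real.sqrt_pos.2 hn').ne'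
        have h2 : √(n : ℝ) * √n = n := Real.mul_self_sqrt hn'.le
        rw [div_inv_eq_mul, eq_comm]
        field_simp
        rw [sq, h2]
      · filter_upwards [eventually_gt_atTop 0] with n hn h
        have hn' : (0 : ℝ) < n := by exact_mod_cast hn
        exact absurd h (by positivity)
    refine ((hmain.const_mul_left (3 * (K : ℝ) ^ 3 + 1)).const_mul_left 2).congr' ?_ .rfl
    filter_upwards [eventually_ge_atTop N] with n hn
    rw [if_pos hn]
  · intro n hev v w hvw
    dsimp only
    split_ifs with hn
    · obtain ⟨h1, h2, h3, h4, h5⟩ := hN n hn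
      have := isProbabilityMeasure_uniformConfiguration hev
      set S := {c : Configuration n Δ | 2 ≤ multigraphDist c.multigraph v w} with hS
      set T := {c : Configuration n Δ | 3 * (n : ℝ) / Real.log n <
        ((distinguishers c.multigraph v w).ncard : ℝ)} with hT
      have hbad := uniformConfiguration_real_few_distinguishers_le hΔ hev hvw hK h3 h4 h2 h1
      have hhalf := uniformConfiguration_real_two_le_dist_ge hΔ hev hvw h5
      rw [← hS] at hhalf
      have hST : (uniformConfiguration n Δ).real (S \ T) ≤
          (3 * (K : ℝ) ^ 3 + 1) * (√n / (n : ℝ) ^ 3) := hbad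
      have hsplit : (uniformConfiguration n Δ).real (S ∩ T) +
          (uniformConfiguration n Δ).real (S \ T) = (uniformConfiguration n Δ).real S :=
        measureReal_inter_add_sdiff .of_discrete
      rw [measureReal_def, cond_apply .of_discrete, ENNReal.toReal_mul, ENNReal.toReal_inv,
        ← measureReal_def, ← measureReal_def]
      set x := (3 * (K : ℝ) ^ 3 + 1) * (√n / (n : ℝ) ^ 3) with hx
      have hx0 : 0 ≤ x := by positivity
      rw [inv_mul_eq_div, le_div_iff₀ (by linarith)]
      nlinarith
    · simp
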